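/- Let $\mathbb G$ be a compact Lie group equipped with a bi-invariant Riemannian metric, let $\mathcal L$ be its Laplace–Beltrami operator, let $\mathrm dx$ be the normalized Haar measure, and let $H^1_{\mathcal L}(\mathbb G)=\{f\in L^2(\mathbb G):(-\mathcal L)^{1/2}f\in L^2(\mathbb G)\}$ with norm $\|f\|_{L^2}+\|(-\mathcal L)^{1/2}f\|_{L^2}$ (real-valued functions). Let $b>0$ and $p,q>1$. Let $u_0,v_0\in H^1_{\mathcal L}(\mathbb G)$ and $u_1,v_1\in L^2(\mathbb G)$ be non-negative functions such that $(u_0,u_1)\ne(0,0)$ and $(v_0,v_1)\neq(0,0)$. For $\varepsilon>0$ consider the weakly coupled system $$\begin{cases}\partial_t^2u-\mathcal Lu+b\,\partial_tu=|v|^p,\\ \partial_t^2v-\mathcal Lv=|u|^q,\end{cases}\qquad (u,\partial_tu)(0,\cdot)=\varepsilon(u_0,u_1),\quad (v,\partial_tv)(0,\cdot)=\varepsilon(v_0,v_1),$$ for $x\in\mathbb G$, $t>0$. For $T>0$, a pair $(u,v)$ is called an energy solution on $[0,T)$ if $$u\in\mathcal C([0,T),H^1_{\mathcal L}(\mathbb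 G))\cap\mathcal C^1([0,T),L^2(\mathbb G))\cap L^q_{\mathrm{loc}}([0,T)\times\mathbb G),$$ $$v\in\mathcal C([0,T),H^1_{\mathcal L}(\mathbb G))\cap\mathcal C^1([0,T),L^2(\mathbb G))\cap L^p_{\mathrm{loc}}([0,T)\times\mathbb G),$$ and, for all $\psi,\varphi\in\mathcal C_0^\infty([0,T)\times\mathbb G)$ and all $t\in(0,T)$, $$\begin{aligned}\int_0^t\!\!\int_{\mathbb G}|v|^p\psi\,\mathrm dx\,\mathrm ds={}&\int_{\mathbb G}\big(\partial_tu\,\psi-u\,\partial_s\psi+b\,u\,\psi\big)(t,x)\,\mathrm dx-\varepsilon\int_{\mathbb G}\big(u_1\psi(0,x)-u_0\,\partial_s\psi(0,x)+b\,u_0\psi(0,x)\big)\,\mathrm dx\\&+\int_0^t\!\!\int_{\mathbb G}u\,\big(\partial_s^2\psi-\mathcal L\psi-b\,\partial_s\psi\big)\,\mathrm dx\,\mathrm ds,\end{aligned}$$ $$\begin{aligned}\int_0^t\!\!\int_{\mathbb G}|u|^q\varphi\,\mathrm dx\,\mathrm ds={}&\int_{\mathbb G}\big(\partial_tv\,\varphi-v\,\partial_s\varphi\big)(t,x)\,\mathrm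 dx-\varepsilon\int_{\mathbb G}\big(v_1\varphi(0,x)-v_0\,\partial_s\varphi(0,x)\big)\,\mathrm dx\\&+\int_0^t\!\!\int_{\mathbb G}v\,\big(\partial_s^2\varphi-\mathcal L\varphi\big)\,\mathrm dx\,\mathrm ds.\end{aligned}$$ The lifespan of $(u,v)$ is $T(\varepsilon)=\sup\{\tau>0:(u,v)\text{ is an energy solution on }[0,\tau)\}\in(0,\infty]$. Then there exist constants $\varepsilon_0>0$ and $C>0$, independent of $\varepsilon$ and of the solution, such that for every $\varepsilon\in(0,\varepsilon_0]$ every energy solution $(u,v)$ blows up in finite time, i.e. $T(\varepsilon)<\infty$, and its lifespan satisfies $$T(\varepsilon)\le\begin{cases}C\,\varepsilon^{-\frac{pq-1}{\max\{2p+1,\,pq+q+1\}}}&\text{if }v_1\neq0,\\[4pt] C\,\varepsilon^{-\frac{pq-1}{\max\{2p+1,\,q+2\}}}&\text{if }v_1=0.\end{cases}$$ -/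

import Mathlib

open MeasureTheory Set
open scoped Manifold ContDiff Topology ENNReal

noncomputable section

/-- A smooth Riemannian metric on a smooth `n`-dimensional manifold `M`. -/
abbrev SmoothMetric (n : ℕ) (M : Type*) [TopologicalSpace M]
    [ChartedSpace (EuclideanSpace ℝ (Fin n)) M] [IsManifold (𝓡 n) ∞ M] :=
  Bundle.ContMDiffRiemannianMetric (𝓡 n) ∞ (EuclideanSpace ℝ (Fin n))
    (TangentSpace (M := M) (𝓡 n))

section LaplaceBeltrami

variable {n : ℕ} {M : Type*} [TopologicalSpace M] [ChartedSpace (EuclideanSpace ℝ (Fin n)) M]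
  [IsManifold (𝓡 n) ∞ M]

/-- The `i`-th coordinate vector field of the preferred chart at `x₀`, at the point with
coordinates `y`. -/
def coordField (x₀ : M) (i : Fin n) (y : EuclideanSpace ℝ (Fin n)) :
    TangentSpace (𝓡 n) ((extChartAt (𝓡 n) x₀).symm y) :=
  mfderiv 𝓘(ℝ, EuclideanSpace ℝ (Fin n)) (𝓡 n) (extChartAt (𝓡 n) x₀).symm y
    (EuclideanSpace.single i (1 : ℝ) : EuclideanSpace ℝ (Fin n))

/-- The matrix `(g_{ij})` of the metric in the preferred chart at `x₀`, at the point with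
coordinates `y`. -/
def metricMatrix (g : SmoothMetric n M) (x₀ : M) (y : EuclideanSpace ℝ (Fin n)) :
    Matrix (Fin n) (Fin n) ℝ :=
  Matrix.of fun i j =>
    g.inner ((extChartAt (𝓡 n) x₀).symm y) (coordField x₀ i y) (coordField x₀ j y)

/-- The `i`-th partial derivative of a function on `ℝⁿ`. -/
def partialDeriv (i : Fin n) (h : EuclideanSpace ℝ (Fin n) → ℝ) (y : EuclideanSpace ℝ (Fin n)) :
    ℝ :=
  fderiv ℝ h y (EuclideanSpace.single i (1 : ℝ))

/-- The Laplace-Beltrami operator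
`𝓛 f = |g|^{-1/2} ∑ᵢ ∂ᵢ (|g|^{1/2} ∑ⱼ g^{ij} ∂ⱼ f)`,
evaluated at `x` in the preferred chart at `x`. -/
def laplaceBeltrami (g : SmoothMetric n M) (f : M → ℝ) (x : M) : ℝ :=
  (Real.sqrt (metricMatrix g x (extChartAt (𝓡 n) x x)).det)⁻¹ *
    ∑ i, partialDeriv i
      (fun y => Real.sqrt (metricMatrix g x y).det *
        ∑ j, (metricMatrix g x y)⁻¹ i j *
          partialDeriv j (f ∘ (extChartAt (𝓡 n) x).symm) y)
      (extChartAt (𝓡 n) x x)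

end LaplaceBeltrami

/-- A Riemannian metric on a Lie group is bi-invariant if all left and right translations are
isometries. -/
def IsBiinvariantMetric {n : ℕ} {G : Type*} [Group G] [TopologicalSpace G]
    [ChartedSpace (EuclideanSpace ℝ (Fin n)) G] [IsManifold (𝓡 n) ∞ G]
    (g : SmoothMetric n G) : Prop :=
  ∀ (a x : G) (v w : TangentSpace (𝓡 n) x),
    g.inner (a * x) (mfderiv (𝓡 n) (𝓡 n) (fun z : G => a * z) x v)
        (mfderiv (𝓡 n) (𝓡 n) (fun z : G => a * z) x w) = g.inner x v w ∧
    g.inner (x * a) (mfderiv (𝓡 n) (𝓡 n) (fun z : G => z * a) x v)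
        (mfderiv (𝓡 n) (𝓡 n) (fun z : G => z * a) x w) = g.inner x v w

section Sobolev

variable {n : ℕ} {M : Type*} [TopologicalSpace M] [ChartedSpace (EuclideanSpace ℝ (Fin n)) M]
  [IsManifold (𝓡 n) ∞ M] [MeasurableSpace M]

/-- `e` is a smooth solution of `-𝓛 e = lam e`. -/
def IsLaplaceEigenfunction (g : SmoothMetric n M) (lam : ℝ) (e : M → ℝ) : Prop :=
  ContMDiff (𝓡 n) 𝓘(ℝ, ℝ) ∞ e ∧ ∀ x, -laplaceBeltrami g e x = lam * e x

/-- `w = (-𝓛)^(σ/2) f` in `L²(M)`, in the sense of the spectral decomposition of `-𝓛`: on a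
compact manifold `L²` is the Hilbert sum of the eigenspaces of `-𝓛` (which consist of smooth
functions), and `(-𝓛)^(σ/2)` acts on the eigenspace of `lam` as multiplication by
`lam^(σ/2)`. -/
def IsFracLaplacian (g : SmoothMetric n M) (μ : Measure M) (σ : ℝ) (f w : Lp ℝ 2 μ) : Prop :=
  ∀ (lam : ℝ) (e : M → ℝ), 0 ≤ lam → IsLaplaceEigenfunction g lam e →
    ∫ x, w x * e x ∂μ = lam ^ (σ / 2) * ∫ x, f x * e x ∂μ

/-- Membership in the Sobolev space `H¹_𝓛 = {f ∈ L² : (-𝓛)^(1/2) f ∈ L²}`. -/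
def MemSobolevH1 (g : SmoothMetric n M) (μ : Measure M) (f : Lp ℝ 2 μ) : Prop :=
  ∃ w : Lp ℝ 2 μ, IsFracLaplacian g μ 1 f w

/-- `u ∈ 𝓒([0,T), H¹_𝓛)`, where `‖f‖_{H¹} = ‖f‖_{L²} + ‖(-𝓛)^(1/2) f‖_{L²}`: both `u` and
`(-𝓛)^(1/2) u` are continuous with values in `L²`. -/
def ContinuousInH1 (g : SmoothMetric n M) (μ : Measure M) (T : ℝ) (u : ℝ → Lp ℝ 2 μ) : Prop :=
  ContinuousOn u (Ico 0 T) ∧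
  ∃ w : ℝ → Lp ℝ 2 μ, (∀ t ∈ Ico 0 T, IsFracLaplacian g μ 1 (u t) (w t)) ∧
    ContinuousOn w (Ico 0 T)

/-- `u ∈ L^r_loc([0,T) × M)` for `M` compact: the function on `[0,T) × M` defined by the curve `u`
is measurable, and `r`-integrable on `[0,t] × M` for every `t < T`. -/
def MemLrLoc (μ : Measure M) (T r : ℝ) (u : ℝ → Lp ℝ 2 μ) : Prop :=
  ∃ w : ℝ × M → ℝ,
    (∀ᵐ s ∂(volume.restrict (Ico 0 T)), (fun x => w (s, x)) =ᵐ[μ] u s) ∧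
    ∀ t ∈ Ico 0 T, MemLp w (ENNReal.ofReal r) ((volume.restrict (Icc 0 t)).prod μ)

/-- The time derivative `∂ₜu(t) ∈ L²` of a curve `u : [0,T) → L²` (one-sided at `t = 0`). -/
def timeDeriv {μ : Measure M} (T : ℝ) (u : ℝ → Lp ℝ 2 μ) (t : ℝ) : Lp ℝ 2 μ :=
  derivWithin u (Ico 0 T) t

/-- `u ∈ 𝓒([0,T), H¹_𝓛) ∩ 𝓒¹([0,T), L²) ∩ L^r_loc([0,T) × M)`. -/
def InEnergyClass (g : SmoothMetric n M) (μ : Measure M) (T r : ℝ) (u : ℝ → Lp ℝ 2 μ) : Prop :=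
  ContinuousInH1 g μ T u ∧ ContDiffOn ℝ 1 u (Ico 0 T) ∧ MemLrLoc μ T r u

end Sobolev

section EnergySolution

variable {n : ℕ} {M : Type*} [TopologicalSpace M] [ChartedSpace (EuclideanSpace ℝ (Fin n)) M]

/-- `ψ ∈ 𝓒₀^∞([0,T) × M)` for `M` compact: `ψ` is the restriction of a smooth function on `ℝ × M`
and vanishes for times close to `T` (but not necessarily at time `0`). -/
def IsTestFunction (T : ℝ) (ψ : ℝ → M → ℝ) : Prop :=
  ContMDiff (𝓘(ℝ, ℝ).prod (𝓡 n)) 𝓘(ℝ, ℝ) ∞ (fun z : ℝ × M => ψ z.1 z.2) ∧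
  ∃ τ < T, ∀ s, τ ≤ s → ∀ x, ψ s x = 0

variable [IsManifold (𝓡 n) ∞ M] [MeasurableSpace M]

/-- The integral relation, for all test functions `ψ` and all `t ∈ (0,T)`, which encodes
`∂ₜ²u - 𝓛u + b ∂ₜu + m² u = |F|^r`, `(u, ∂ₜu)(0) = ε (u₀, u₁)`. -/
def WeakWaveRelation (g : SmoothMetric n M) (μ : Measure M) (b m r ε T : ℝ)
    (u₀ u₁ : Lp ℝ 2 μ) (u F : ℝ → Lp ℝ 2 μ) : Prop :=
  ∀ ψ : ℝ → M → ℝ, IsTestFunction (n := n) T ψ → ∀ t ∈ Ioo 0 T,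
    ∫ s in (0 : ℝ)..t, ∫ x, |F s x| ^ r * ψ s x ∂μ =
      (∫ x, timeDeriv T u t x * ψ t x ∂μ)
      - (∫ x, u t x * deriv (fun s => ψ s x) t ∂μ)
      + b * (∫ x, u t x * ψ t x ∂μ)
      - ε * (∫ x, u₁ x * ψ 0 x ∂μ)
      + ε * (∫ x, u₀ x * deriv (fun s => ψ s x) 0 ∂μ)
      - ε * b * (∫ x, u₀ x * ψ 0 x ∂μ)
      + ∫ s in (0 : ℝ)..t, ∫ x, u s x *
          (iteratedDeriv 2 (fun s' => ψ s' x) s - laplaceBeltrami g (ψ s) x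
            - b * deriv (fun s' => ψ s' x) s + m ^ 2 * ψ s x) ∂μ

/-- `(u,v)` is an energy solution on `[0,T)` of the weakly coupled system
`∂ₜ²u - 𝓛u + b ∂ₜu + m² u = |v|^p`, `∂ₜ²v - 𝓛v = |u|^q`
with Cauchy data `ε (u₀,u₁)` and `ε (v₀,v₁)`. -/
def IsEnergySolution (g : SmoothMetric n M) (μ : Measure M) (b m p q ε : ℝ)
    (u₀ u₁ v₀ v₁ : Lp ℝ 2 μ) (T : ℝ) (u v : ℝ → Lp ℝ 2 μ) : Prop :=
  InEnergyClass g μ T q u ∧ InEnergyClass g μ T p v ∧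
  WeakWaveRelation g μ b m p ε T u₀ u₁ u v ∧
  WeakWaveRelation g μ 0 0 q ε T v₀ v₁ v u

/-- The lifespan `sup {τ > 0 : (u,v) is an energy solution on [0,τ)} ∈ [0,∞]`. -/
def lifespan (g : SmoothMetric n M) (μ : Measure M) (b m p q ε : ℝ)
    (u₀ u₁ v₀ v₁ : Lp ℝ 2 μ) (u v : ℝ → Lp ℝ 2 μ) : ℝ≥0∞ :=
  sSup (ENNReal.ofReal ''
    {τ : ℝ | 0 < τ ∧ IsEnergySolution g μ b m p q ε u₀ u₁ v₀ v₁ τ u v})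

end EnergySolution

end

/-! A test function of time alone annihilates the Laplacian, so only the means over the group
matter: `U'' + bU' = ∫|v|^p ≥ |V|^p` and `V'' = ∫|u|^q ≥ |U|^q` weakly, by Jensen. The geometry
plays no further role.

Test with `φ (s / τ)`, where `φ` vanishes on `[1, ∞)`. Let `X`, `Y` be the weighted integrals of
`|v|^p`, `|u|^q`, and `A`, `B` lower bounds for the data terms. Hölder gives, for `τ ≥ 1`, `(X +
A)^q ≲ τ⁻¹ Y` (damping leaves one factor `1/τ`) and `(Y + B)^p ≲ τ^(-(p+1)) X`
(`WeakWaveRelation.rpow_le`). Eliminating `Y` or `X` (`rpow_le_of_coupled`) yields `A^(pq-1) ≲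
τ^(-(2p+1))` and `B^(pq-1) ≲ τ^(-(pq+q+1))`.

Here `A ~ ε(∫u₁ + b∫u₀)` and `B ~ ε(∫v₁ + τ⁻¹∫v₀)`. If `v₁ = 0`, the factor `τ⁻¹` in `B` lowers
`pq+q+1` to `q+2`. Each bound limits `τ`, and the better one gives the maximum in the exponent. -/

/-! ### The time cutoff -/

/-- A smooth nonnegative profile on the half line, supported in `[0,1]`, whose first two
derivatives are controlled by a power less than one of the profile itself. -/
theorem exists_smooth_profile {θ : ℝ} (hθ : 0 < θ) (hθ1 : θ < 1) :
    ∃ φ : ℝ → ℝ, ContDiff ℝ ∞ φ ∧ (∀ s, 0 ≤ φ s) ∧ (∀ s, 0 ≤ s → φ s ≤ 1) ∧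
      (∀ s, 1 ≤ s → φ s = 0) ∧ 0 < φ 0 ∧ deriv φ 0 < 0 ∧
      ∃ K : ℝ, 0 < K ∧ ∀ s, 0 ≤ s →
        |deriv φ s| ≤ K * φ s ^ θ ∧ |iteratedDeriv 2 φ s| ≤ K * φ s ^ θ := by
  -- The profile is `η ^ k`; its second derivative retains a factor `η ^ (k - 2)`, which is at most
  -- `(η ^ k) ^ θ` for `0 ≤ η ≤ 1` once `k - 2 ≥ kθ`.
  obtain ⟨k, hk⟩ := exists_nat_gt (2 / (1 - θ))
  have h1θ : 0 < 1 - θ := by linarith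
  have hkθ : 2 < k * (1 - θ) := by rwa [div_lt_iff₀ h1θ] at hk
  have hk2 : 2 < k := by
    have : (2 : ℝ) < k := by nlinarith [(Nat.cast_nonneg k : (0 : ℝ) ≤ k)]
    exact_mod_cast this
  set η : ℝ → ℝ := fun s => expNegInvGlue (1 - s) with hηdef
  have hη : ContDiff ℝ ∞ η := expNegInvGlue.contDiff.comp (contDiff_const.sub contDiff_id)
  have hη0 : ∀ s, 0 ≤ η s := fun s => expNegInvGlue.nonneg _
  have hη1 : ∀ s, 0 ≤ s → η s ≤ 1 := by
    intro s _
    simp only [hηdef, expNegInvGlue]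
    split_ifs with h
    · exact zero_le_one
    · rw [Real.exp_le_one_iff, neg_nonpos, inv_nonneg]; linarith
  have hηz : ∀ s, 1 ≤ s → η s = 0 := fun s hs => expNegInvGlue.zero_of_nonpos (by linarith)
  have hd : Differentiable ℝ η := hη.differentiable (by simp)
  have hη' : ContDiff ℝ ∞ (deriv η) := (contDiff_infty_iff_deriv.1 hη).2
  have hd' : Differentiable ℝ (deriv η) := hη'.differentiable (by simp)
  have hη'' : ContDiff ℝ ∞ (deriv (deriv η)) := (contDiff_infty_iff_deriv.1 hη').2
  have hφ' : deriv (fun s => η s ^ k) = fun s => k * η s ^ (k - 1) * deriv η s := by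
    funext s
    exact ((hd s).hasDerivAt.pow k).deriv
  have hφ'' : ∀ s, iteratedDeriv 2 (fun s => η s ^ k) s =
      k * ((k - 1 : ℕ) * η s ^ (k - 1 - 1) * deriv η s * deriv η s
        + η s ^ (k - 1) * deriv (deriv η) s) := by
    intro s
    rw [iteratedDeriv_succ, iteratedDeriv_one, hφ']
    have h := ((((hd s).hasDerivAt.pow (k - 1)).const_mul (k : ℝ)).mul (hd' s).hasDerivAt).deriv
    simp only [Pi.mul_def, Pi.pow_apply] at h
    rw [h]; ring
  -- Strictness matters: `-φ'(0)` is the weight with which `v₀` enters, the only datum left when `v₁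
  -- = 0`.
  have hder0 : deriv η 0 < 0 := by
    have heq : η =ᶠ[𝓝 0] fun s => Real.exp (-(1 - s)⁻¹) := by
      filter_upwards [Iio_mem_nhds (zero_lt_one : (0 : ℝ) < 1)] with s hs
      simp only [hηdef, expNegInvGlue]
      rw [if_neg (by simp only [mem_Iio] at hs; linarith)]
    have h : HasDerivAt (fun s : ℝ => Real.exp (-(1 - s)⁻¹)) (-Real.exp (-1)) 0 := by
      have h1 : HasDerivAt (fun s : ℝ => 1 - s) (-1) 0 := by
        simpa using (hasDerivAt_id (0 : ℝ)).const_sub 1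
      have h2 := (h1.inv (by norm_num)).neg.exp
      exact h2.congr_deriv (by change Real.exp (-(1 - 0)⁻¹) * _ = _; norm_num)
    rw [heq.deriv_eq, h.deriv]
    exact neg_lt_zero.2 (Real.exp_pos _)
  obtain ⟨A, hA⟩ := (isCompact_Icc (a := (0 : ℝ)) (b := 1)).exists_bound_of_continuousOn
    hη'.continuous.continuousOn
  obtain ⟨B, hB⟩ := (isCompact_Icc (a := (0 : ℝ)) (b := 1)).exists_bound_of_continuousOn
    hη''.continuous.continuousOn
  have hA0 : 0 ≤ A := (norm_nonneg _).trans (hA 0 (by simp))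
  have hB0 : 0 ≤ B := (norm_nonneg _).trans (hB 0 (by simp))
  have hη0pos : 0 < η 0 := expNegInvGlue.pos_of_pos (by norm_num)
  have hkpos : (0 : ℝ) < k := by exact_mod_cast (by omega : 0 < k)
  refine ⟨fun s => η s ^ k, hη.pow k, fun s => pow_nonneg (hη0 s) k,
    fun s hs => pow_le_one₀ (hη0 s) (hη1 s hs),
    fun s hs => by simp only [hηz s hs]; exact zero_pow (by omega), pow_pos hη0pos k, ?_,
    k * A + k * (k * A * A + B) + 1, by positivity, ?_⟩
  · rw [hφ']
    exact mul_neg_of_pos_of_neg (by positivity) hder0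
  intro s hs
  rcases le_or_gt 1 s with h1 | h1
  · have e1 : deriv (fun s => η s ^ k) s = 0 := by
      rw [hφ']; simp [hηz s h1, show k - 1 ≠ 0 by omega]
    have e2 : iteratedDeriv 2 (fun s => η s ^ k) s = 0 := by
      rw [hφ'' s]; simp [hηz s h1, show k - 1 ≠ 0 by omega, show k - 1 - 1 ≠ 0 by omega]
    rw [e1, e2, abs_zero]
    have : 0 ≤ (η s ^ k) ^ θ := Real.rpow_nonneg (pow_nonneg (hη0 s) k) θ
    constructor <;> positivity
  have hsI : s ∈ Icc (0 : ℝ) 1 := ⟨hs, h1.le⟩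
  have hpos : 0 < η s := expNegInvGlue.pos_of_pos (by linarith)
  have hA' : |deriv η s| ≤ A := by simpa using hA s hsI
  have hB' : |deriv (deriv η) s| ≤ B := by simpa using hB s hsI
  have hle : η s ^ (k - 1 - 1) ≤ (η s ^ k) ^ θ := by
    rw [← Real.rpow_natCast, ← Real.rpow_natCast (η s) k, ← Real.rpow_mul hpos.le]
    apply Real.rpow_le_rpow_of_exponent_ge hpos (hη1 s hs)
    have : ((k - 1 - 1 : ℕ) : ℝ) = k - 2 := by
      rw [Nat.sub_sub, Nat.cast_sub (by omega)]; norm_num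
    rw [this]; nlinarith
  have hle1 : η s ^ (k - 1) ≤ η s ^ (k - 1 - 1) :=
    pow_le_pow_of_le_one hpos.le (hη1 s hs) (by omega)
  set Z := (η s ^ k) ^ θ
  have hZ : 0 ≤ Z := (pow_nonneg hpos.le _).trans hle
  have hk1 : ((k - 1 : ℕ) : ℝ) ≤ k := by exact_mod_cast Nat.sub_le k 1
  have hn1 : 0 ≤ η s ^ (k - 1) := pow_nonneg hpos.le _
  have hn2 : 0 ≤ η s ^ (k - 1 - 1) := pow_nonneg hpos.le _
  have b1 : |deriv (fun s => η s ^ k) s| ≤ k * A * Z := by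
    rw [hφ']
    simp only [abs_mul, Nat.abs_cast, abs_of_nonneg hn1]
    calc (k : ℝ) * η s ^ (k - 1) * |deriv η s| ≤ k * Z * A := by
          gcongr; exact hle1.trans hle
      _ = k * A * Z := by ring
  have b2 : |iteratedDeriv 2 (fun s => η s ^ k) s| ≤ k * (k * A * A + B) * Z := by
    rw [hφ'' s, abs_mul, Nat.abs_cast]
    calc (k : ℝ) * |(k - 1 : ℕ) * η s ^ (k - 1 - 1) * deriv η s * deriv η s
          + η s ^ (k - 1) * deriv (deriv η) s|
        ≤ k * ((k - 1 : ℕ) * η s ^ (k - 1 - 1) * |deriv η s| * |deriv η s|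
          + η s ^ (k - 1) * |deriv (deriv η) s|) := by
          gcongr
          refine (abs_add_le _ _).trans_eq ?_
          simp only [abs_mul, Nat.abs_cast, abs_of_nonneg hn1, abs_of_nonneg hn2]
      _ ≤ k * (k * Z * A * A + Z * B) := by
          gcongr; exact hle1.trans hle
      _ = k * (k * A * A + B) * Z := by ring
  have hkA : 0 ≤ k * A * Z := by positivity
  have hkB : 0 ≤ k * (k * A * A + B) * Z := by positivity
  constructor <;> nlinarith

/-! ### Testing with functions of time -/

/-- Removes the spatial operator when the test function depends on time only. -/
theorem laplaceBeltrami_const {n : ℕ} {M : Type*} [TopologicalSpace M]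
    [ChartedSpace (EuclideanSpace ℝ (Fin n)) M] [IsManifold (𝓡 n) ∞ M]
    (g : SmoothMetric n M) (c : ℝ) (x : M) : laplaceBeltrami g (fun _ => c) x = 0 := by
  have h : ((fun _ => c) ∘ (extChartAt (𝓡 n) x).symm : EuclideanSpace ℝ (Fin n) → ℝ)
      = fun _ => c := rfl
  simp only [laplaceBeltrami, partialDeriv, h]
  simp

/-- The weak relation tested against a function `φ (s / τ)` of time only. -/
theorem WeakWaveRelation.test_profile {n : ℕ} {M : Type*} [TopologicalSpace M]
    [ChartedSpace (EuclideanSpace ℝ (Fin n)) M] [IsManifold (𝓡 n) ∞ M] [MeasurableSpace M]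
    {g : SmoothMetric n M} {μ : Measure M} {b r ε T τ : ℝ} {u₀ u₁ : Lp ℝ 2 μ}
    {u F : ℝ → Lp ℝ 2 μ} (h : WeakWaveRelation g μ b 0 r ε T u₀ u₁ u F)
    (hτ : 0 < τ) (hτT : τ < T) {φ : ℝ → ℝ} (hφ : ContDiff ℝ ∞ φ)
    (hφ1 : ∀ s, 1 ≤ s → φ s = 0) (hφd : deriv φ 1 = 0) :
    (∫ s in (0 : ℝ)..τ, (∫ x, |F s x| ^ r ∂μ) * φ (s / τ)) +
      ε * (φ 0 * (∫ x, u₁ x ∂μ) + (-deriv φ 0 / τ + b * φ 0) * ∫ x, u₀ x ∂μ) =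
    ∫ s in (0 : ℝ)..τ, (∫ x, u s x ∂μ) *
      (iteratedDeriv 2 φ (s / τ) / τ ^ 2 - b * (deriv φ (s / τ) / τ)) := by
  have hd1 : ∀ s, deriv (fun s => φ (s / τ)) s = deriv φ (s / τ) / τ := by
    intro s
    have h1 : HasDerivAt (fun s => s / τ) (1 / τ) s := (hasDerivAt_id s).div_const τ
    have h2 := ((hφ.differentiable (by simp) (s / τ)).hasDerivAt.comp s h1).deriv
    rw [show (fun s => φ (s / τ)) = φ ∘ fun s => s / τ from rfl, h2]; ring
  have hφ' : Differentiable ℝ (deriv φ) :=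
    (contDiff_infty_iff_deriv.1 hφ).2.differentiable (by simp)
  have hd2 : ∀ s, iteratedDeriv 2 (fun s => φ (s / τ)) s = iteratedDeriv 2 φ (s / τ) / τ ^ 2 := by
    intro s
    rw [iteratedDeriv_succ, iteratedDeriv_one, iteratedDeriv_succ, iteratedDeriv_one,
      funext hd1]
    have h1 : HasDerivAt (fun s => s / τ) (1 / τ) s := (hasDerivAt_id s).div_const τ
    have h2 := (((hφ' (s / τ)).hasDerivAt.comp s h1).div_const τ).deriv
    simp only [Function.comp_def] at h2
    rw [h2]; field_simp
  have htest : IsTestFunction (n := n) (M := M) T (fun s _ => φ (s / τ)) := by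
    refine ⟨?_, τ, hτT, fun s hs _ => hφ1 _ ((one_le_div hτ).2 hs)⟩
    have hc : ContDiff ℝ ∞ fun s => φ (s / τ) := hφ.comp (contDiff_id.div_const τ)
    exact hc.contMDiff.comp contMDiff_fst
  -- At `t = τ` the boundary terms carry `φ 1` and `deriv φ 1`, both zero, so only the Cauchy data
  -- remain.
  have key := h _ htest τ ⟨hτ, hτT⟩
  simp only [hd1, hd2, laplaceBeltrami_const, integral_mul_const, div_self hτ.ne', zero_div,
    hφ1 1 le_rfl, hφd, sub_zero, mul_zero, add_zero, integral_zero, ne_eq, OfNat.ofNat_ne_zero,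
    not_false_eq_true, zero_pow, zero_mul] at key
  rw [key]
  ring

/-! ### Jensen, Hölder and elimination -/

/-- An energy-class curve has, for each time before `T`, an integrable `L^r`-norm power, which
dominates the power of its mean. -/
theorem MemLrLoc.integrableOn_and_mean_le {M : Type*} [MeasurableSpace M] {μ : Measure M}
    [IsProbabilityMeasure μ] {T r τ : ℝ} {u : ℝ → Lp ℝ 2 μ} (hr : 1 < r) (h : MemLrLoc μ T r u)
    (hτ : 0 ≤ τ) (hτT : τ < T) :
    IntegrableOn (fun s => ∫ x, |u s x| ^ r ∂μ) (Icc 0 τ) ∧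
      ∀ᵐ s ∂(volume.restrict (Icc 0 τ)), |∫ x, u s x ∂μ| ^ r ≤ ∫ x, |u s x| ^ r ∂μ := by
  obtain ⟨w, hw, hwi⟩ := h
  have hw' : ∀ᵐ s ∂(volume.restrict (Icc 0 τ)), (fun x => w (s, x)) =ᵐ[μ] u s :=
    ae_mono (Measure.restrict_mono (Icc_subset_Ico_right hτT) le_rfl) hw
  have hr0 : 0 < r := by linarith
  have hint : Integrable (fun z => |w z| ^ r) ((volume.restrict (Icc 0 τ)).prod μ) := by
    have := (hwi τ ⟨hτ, hτT⟩).integrable_norm_rpow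
      (by simpa using hr0) ENNReal.ofReal_ne_top
    simpa [ENNReal.toReal_ofReal hr0.le] using this
  have heq : ∀ᵐ s ∂(volume.restrict (Icc 0 τ)),
      ∫ x, |w (s, x)| ^ r ∂μ = ∫ x, |u s x| ^ r ∂μ := by
    filter_upwards [hw'] with s hs
    exact integral_congr_ae (hs.fun_comp fun y => |y| ^ r)
  refine ⟨hint.integral_prod_left.congr heq, ?_⟩
  filter_upwards [hw', hint.prod_right_ae] with s hs hsi
  have hui : Integrable (u s) μ := (Lp.memLp (u s)).integrable (by norm_num)
  have hur : Integrable (fun x => |u s x| ^ r) μ :=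
    hsi.congr (hs.fun_comp fun y => |y| ^ r)
  -- Jensen for `y ↦ y ^ r` on `[0, ∞)`; `μ` has total mass one, so no constant appears.
  have hj := (convexOn_rpow hr.le).map_integral_le (μ := μ) (f := fun x => |u s x|)
    (Real.continuous_rpow_const hr0.le).continuousOn isClosed_Ici
    (by simp) hui.abs hur
  exact (Real.rpow_le_rpow (abs_nonneg _) (abs_integral_le_integral_abs) hr0.le).trans hj

/-- Weighted Hölder inequality on `[0,τ]`. -/
theorem abs_integral_mul_rpow_le {r τ D : ℝ} {U h f k : ℝ → ℝ} (hr : 1 < r) (hτ : 0 < τ)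
    (hD : 0 ≤ D) (hU : ContinuousOn U (Icc 0 τ)) (hh : IntegrableOn h (Icc 0 τ))
    (hUh : ∀ᵐ s ∂(volume.restrict (Icc 0 τ)), |U s| ^ r ≤ h s)
    (hf : Continuous f) (hf0 : ∀ s, 0 ≤ f s)
    (hk : ∀ s ∈ Icc 0 τ, |k s| ≤ D * f s ^ (1 / r)) :
    |∫ s in (0 : ℝ)..τ, U s * k s| ^ r ≤
      D ^ r * τ ^ (r - 1) * ∫ s in (0 : ℝ)..τ, h s * f s := by
  have hr0 : 0 < r := by linarith
  have hrc : r.HolderConjugate (r / (r - 1)) := Real.HolderConjugate.conjExponent hr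
  rw [intervalIntegral.integral_of_le hτ.le, intervalIntegral.integral_of_le hτ.le,
    ← integral_Icc_eq_integral_Ioc, ← integral_Icc_eq_integral_Ioc]
  set ν : Measure ℝ := volume.restrict (Icc 0 τ) with hν
  have hfr : ContinuousOn (fun s => f s ^ (1 / r)) (Icc 0 τ) :=
    hf.continuousOn.rpow_const fun s _ => Or.inr (by positivity)
  have hGc : ContinuousOn (fun s => |U s| * f s ^ (1 / r)) (Icc 0 τ) := hU.abs.mul hfr
  have hG0 : ∀ s, 0 ≤ |U s| * f s ^ (1 / r) := fun s =>
    mul_nonneg (abs_nonneg _) (Real.rpow_nonneg (hf0 s) _)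
  have hGi : Integrable (fun s => |U s| * f s ^ (1 / r)) ν := hGc.integrableOn_Icc
  have hGr : ∀ s, (|U s| * f s ^ (1 / r)) ^ r = |U s| ^ r * f s := by
    intro s
    rw [Real.mul_rpow (abs_nonneg _) (Real.rpow_nonneg (hf0 s) _), ← Real.rpow_mul (hf0 s),
      one_div_mul_cancel hr0.ne', Real.rpow_one]
  have step1 : |∫ s, U s * k s ∂ν| ≤ D * ∫ s, |U s| * f s ^ (1 / r) ∂ν := by
    rw [← integral_const_mul]
    refine norm_integral_le_of_norm_le (f := fun s => U s * k s) (hGi.const_mul D) ?_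
    filter_upwards [ae_restrict_mem measurableSet_Icc] with s hs
    rw [Real.norm_eq_abs, abs_mul]
    calc |U s| * |k s| ≤ |U s| * (D * f s ^ (1 / r)) := by gcongr; exact hk s hs
      _ = _ := by ring
  have hGL : MemLp (fun s => |U s| * f s ^ (1 / r)) (ENNReal.ofReal r) ν := by
    obtain ⟨C, hC⟩ := isCompact_Icc.exists_bound_of_continuousOn hGc
    exact MemLp.of_bound hGi.aestronglyMeasurable C
      ((ae_restrict_mem measurableSet_Icc).mono hC)
  -- Hölder against the constant `1`; its norm on `[0, τ]` becomes `τ ^ (r - 1)` after raising to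
  -- the power `r`.
  have step2 : ∫ s, |U s| * f s ^ (1 / r) ∂ν ≤
      (∫ s, |U s| ^ r * f s ∂ν) ^ (1 / r) * τ ^ (1 / (r / (r - 1))) := by
    have := integral_mul_le_Lp_mul_Lq_of_nonneg (μ := ν) hrc (f := fun s => |U s| * f s ^ (1 / r))
      (g := fun _ => 1) (Filter.Eventually.of_forall hG0)
      (Filter.Eventually.of_forall fun _ => zero_le_one) hGL (memLp_const 1)
    simp only [mul_one, hGr, Real.one_rpow] at this
    simpa [hν, hτ.le] using this
  have hmono : ∫ s, |U s| ^ r * f s ∂ν ≤ ∫ s, h s * f s ∂ν := by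
    refine integral_mono_ae ?_ ?_ ?_
    · exact ((hU.abs.rpow_const fun s _ => Or.inr hr0.le).mul hf.continuousOn).integrableOn_Icc
    · exact hh.mul_continuousOn hf.continuousOn isCompact_Icc
    · filter_upwards [hUh] with s hs
      exact mul_le_mul_of_nonneg_right hs (hf0 s)
  have hI0 : 0 ≤ ∫ s, |U s| ^ r * f s ∂ν :=
    integral_nonneg fun s => mul_nonneg (Real.rpow_nonneg (abs_nonneg _) _) (hf0 s)
  calc |∫ s, U s * k s ∂ν| ^ r
      ≤ (D * ((∫ s, |U s| ^ r * f s ∂ν) ^ (1 / r) * τ ^ (1 / (r / (r - 1))))) ^ r := by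
        gcongr
        exact step1.trans (by gcongr)
    _ = D ^ r * τ ^ (r - 1) * ∫ s, |U s| ^ r * f s ∂ν := by
        rw [Real.mul_rpow hD (by positivity), Real.mul_rpow (by positivity) (by positivity),
          ← Real.rpow_mul hI0, ← Real.rpow_mul hτ.le, one_div_mul_cancel hr0.ne', Real.rpow_one,
          show 1 / (r / (r - 1)) * r = r - 1 by
            have : r - 1 ≠ 0 := by linarith
            field_simp]
        ring
    _ ≤ _ := by gcongr

/-- Two coupled power inequalities force a bound on the source term. -/
theorem rpow_le_of_coupled {p q X Y A K L : ℝ} (hp : 1 < p) (hq : 1 < q) (hX : 0 ≤ X)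
    (hY : 0 ≤ Y) (hA : 0 ≤ A) (hK : 0 ≤ K) (hL : 0 ≤ L) (h₁ : (X + A) ^ q ≤ K * Y)
    (h₂ : Y ^ p ≤ L * X) :
    A ^ (p * q - 1) ≤ K ^ p * L := by
  have hp0 : 0 < p := by linarith
  have hpq : 0 < p * q - 1 := by nlinarith
  rcases hA.eq_or_lt with rfl | hA'
  · rw [Real.zero_rpow hpq.ne']; positivity
  have hS : 0 < X + A := by linarith
  -- Enlarging `X` to `X + A` on the right puts the same base on both sides, so one factor cancels
  -- and `pq - 1` remains.
  have h3 : (X + A) ^ (p * q - 1) * (X + A) ≤ K ^ p * L * (X + A) := by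
    calc (X + A) ^ (p * q - 1) * (X + A) = ((X + A) ^ q) ^ p := by
          rw [← Real.rpow_mul hS.le, mul_comm q p, ← Real.rpow_add_one hS.ne', sub_add_cancel]
      _ ≤ (K * Y) ^ p := by gcongr
      _ = K ^ p * Y ^ p := Real.mul_rpow hK hY
      _ ≤ K ^ p * (L * (X + A)) := by
          gcongr
          exact h₂.trans (by gcongr; linarith)
      _ = _ := by ring
  calc A ^ (p * q - 1) ≤ (X + A) ^ (p * q - 1) := by gcongr; linarith
    _ ≤ _ := le_of_mul_le_mul_right h3 hS

/-- If `(ε Q)ᵃ τᵐ` stays bounded for `1 ≤ τ < T`, then `T` is at most of order `ε ^ (-a/m)`. -/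
theorem le_mul_rpow_of_forall_rpow_mul_rpow_le {ε Q T a m K : ℝ} (hε : 0 < ε) (hε1 : ε ≤ 1)
    (hQ : 0 < Q) (ha : 0 ≤ a) (hm : 0 < m) (hK : 0 ≤ K)
    (h : ∀ τ, 1 ≤ τ → τ < T → (ε * Q) ^ a * τ ^ m ≤ K) :
    T ≤ max 1 ((K / Q ^ a) ^ (1 / m)) * ε ^ (-(a / m)) := by
  have hε2 : 1 ≤ ε ^ (-(a / m)) :=
    Real.one_le_rpow_of_pos_of_le_one_of_nonpos hε hε1 (neg_nonpos.2 (by positivity))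
  refine le_of_forall_lt fun τ hτT => ?_
  -- The hypothesis covers only times in `[1, T)`; smaller times are absorbed by the `max 1` and `ε
  -- ≤ 1`.
  obtain ⟨σ, hτσ, hσT⟩ := exists_between hτT
  refine hτσ.trans_le ?_
  rcases le_or_gt σ 1 with hσ | hσ
  · exact hσ.trans (one_le_mul_of_one_le_of_one_le (le_max_left _ _) hε2)
  have hσ0 : 0 < σ := by linarith
  have hk := h σ hσ.le hσT
  rw [Real.mul_rpow hε.le hQ.le] at hk
  have h1 : σ ^ m ≤ K / Q ^ a * ε ^ (-a) := by
    rw [Real.rpow_neg hε.le, ← div_eq_mul_inv, div_div, le_div_iff₀ (by positivity)]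
    linarith
  calc σ = (σ ^ m) ^ (1 / m) := by
        rw [← Real.rpow_mul hσ0.le, mul_one_div_cancel hm.ne', Real.rpow_one]
    _ ≤ (K / Q ^ a * ε ^ (-a)) ^ (1 / m) := by gcongr
    _ = (K / Q ^ a) ^ (1 / m) * ε ^ (-(a / m)) := by
        rw [Real.mul_rpow (by positivity) (by positivity), ← Real.rpow_mul hε.le]
        congr 2; ring
    _ ≤ _ := by gcongr; exact le_max_right _ _

/-! ### Means of `L²` functions -/

theorem Lp.integral_nonneg_of_nonneg {M : Type*} [MeasurableSpace M] {μ : Measure M}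
    {f : Lp ℝ 2 μ} (hf : 0 ≤ f) : 0 ≤ ∫ x, f x ∂μ :=
  integral_nonneg_of_ae ((Lp.coeFn_nonneg f).2 hf)

theorem Lp.integral_pos_of_nonneg_of_ne_zero {M : Type*} [MeasurableSpace M] {μ : Measure M}
    [IsFiniteMeasure μ] {f : Lp ℝ 2 μ} (hf : 0 ≤ f) (hf0 : f ≠ 0) : 0 < ∫ x, f x ∂μ := by
  refine lt_of_le_of_ne (Lp.integral_nonneg_of_nonneg hf) fun h => hf0 ?_
  have h0 := (integral_eq_zero_iff_of_nonneg_ae ((Lp.coeFn_nonneg f).2 hf)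
    ((Lp.memLp f).integrable (by norm_num))).1 h.symm
  exact (Lp.eq_zero_iff_ae_eq_zero).2 h0

/-- The mean is the inner product with the constant `1`; this makes the mean of an energy solution
continuous in time. -/
theorem Lp.continuous_integral {M : Type*} [MeasurableSpace M] {μ : Measure M}
    [IsProbabilityMeasure μ] : Continuous fun f : Lp ℝ 2 μ => ∫ x, f x ∂μ := by
  have h : (fun f : Lp ℝ 2 μ => ∫ x, f x ∂μ) =
      fun f => inner ℝ ((memLp_const (1 : ℝ)).toLp (fun _ : M => (1 : ℝ))) f := by
    funext f
    rw [L2.inner_def]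
    refine integral_congr_ae ?_
    filter_upwards [(memLp_const (p := 2) (μ := μ) (1 : ℝ)).coeFn_toLp] with x hx
    rw [hx]
    simp
  rw [h]
  fun_prop

/-! ### A priori bounds -/

section
variable {n : ℕ} {M : Type*} [TopologicalSpace M] [ChartedSpace (EuclideanSpace ℝ (Fin n)) M]
  [IsManifold (𝓡 n) ∞ M] [MeasurableSpace M]

/-- The energy estimate obtained by testing one equation of the system against a time profile. -/
theorem WeakWaveRelation.rpow_le {g : SmoothMetric n M} {μ : Measure M} [IsProbabilityMeasure μ]
    {b r r' ε T τ D : ℝ} {u₀ u₁ : Lp ℝ 2 μ} {u F : ℝ → Lp ℝ 2 μ}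
    (h : WeakWaveRelation g μ b 0 r ε T u₀ u₁ u F) (hr' : 1 < r') (hu : InEnergyClass g μ T r' u)
    (hτ : 0 < τ) (hτT : τ < T) {φ : ℝ → ℝ} (hφ : ContDiff ℝ ∞ φ) (hφ0 : ∀ s, 0 ≤ φ s)
    (hφ1 : ∀ s, 1 ≤ s → φ s = 0) (hφd : deriv φ 1 = 0) (hD : 0 ≤ D)
    (hφD : ∀ s, 0 ≤ s →
      |iteratedDeriv 2 φ s / τ ^ 2 - b * (deriv φ s / τ)| ≤ D * φ s ^ (1 / r'))
    (hpos : 0 ≤ ε * (φ 0 * (∫ x, u₁ x ∂μ) + (-deriv φ 0 / τ + b * φ 0) * ∫ x, u₀ x ∂μ)) :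
    ((∫ s in (0 : ℝ)..τ, (∫ x, |F s x| ^ r ∂μ) * φ (s / τ)) +
      ε * (φ 0 * (∫ x, u₁ x ∂μ) + (-deriv φ 0 / τ + b * φ 0) * ∫ x, u₀ x ∂μ)) ^ r' ≤
    D ^ r' * τ ^ (r' - 1) * ∫ s in (0 : ℝ)..τ, (∫ x, |u s x| ^ r' ∂μ) * φ (s / τ) := by
  obtain ⟨hi, hm⟩ := hu.2.2.integrableOn_and_mean_le hr' hτ.le hτT
  have hU : ContinuousOn (fun s => ∫ x, u s x ∂μ) (Icc 0 τ) :=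
    Lp.continuous_integral.comp_continuousOn (hu.1.1.mono (Icc_subset_Ico_right hτT))
  have hH := abs_integral_mul_rpow_le (f := fun s => φ (s / τ)) hr' hτ hD hU hi hm
    (hφ.continuous.comp (continuous_id.div_const τ)) (fun s => hφ0 _)
    (fun s hs => hφD (s / τ) (div_nonneg hs.1 hτ.le))
  -- The integral in absolute value equals source plus data, which is nonnegative.
  rw [← h.test_profile hτ hτT hφ hφ1 hφd, abs_of_nonneg] at hH
  · exact hH
  · refine add_nonneg (intervalIntegral.integral_nonneg hτ.le fun s _ => ?_) hpos
    exact mul_nonneg (integral_nonneg fun x => Real.rpow_nonneg (abs_nonneg _) _) (hφ0 _)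

/-- A priori bounds relating the means of the Cauchy data to the time of existence of an energy
solution. -/
theorem IsEnergySolution.exists_bound (g : SmoothMetric n M) (μ : Measure M)
    [IsProbabilityMeasure μ] {b p q : ℝ} (hb : 0 < b) (hp : 1 < p) (hq : 1 < q) :
    ∃ K : ℝ, 0 ≤ K ∧ ∀ (u₀ u₁ v₀ v₁ : Lp ℝ 2 μ), 0 ≤ u₀ → 0 ≤ u₁ → 0 ≤ v₀ → 0 ≤ v₁ →
      ∀ (ε T τ : ℝ) (u v : ℝ → Lp ℝ 2 μ), 0 < ε → 1 ≤ τ → τ < T →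
        IsEnergySolution g μ b 0 p q ε u₀ u₁ v₀ v₁ T u v →
        (ε * ((∫ x, u₁ x ∂μ) + b * ∫ x, u₀ x ∂μ)) ^ (p * q - 1) * τ ^ (2 * p + 1) ≤ K ∧
        (ε * ((∫ x, v₁ x ∂μ) + (∫ x, v₀ x ∂μ) / τ)) ^ (p * q - 1) * τ ^ (p * q + q + 1) ≤ K := by
  have hp0 : 0 < p := by linarith
  have hq0 : 0 < q := by linarith
  have hpq : 0 < p * q - 1 := by nlinarith
  -- The larger of `1/p` and `1/q` lets one profile serve both equations, since `0 ≤ φ ≤ 1` on `[0,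
  -- ∞)`.
  obtain ⟨φ, hφ, hφ0, hφle, hφ1, hφpos, hφneg, K, hK, hφK⟩ :=
    exists_smooth_profile (θ := max (1 / p) (1 / q)) (by positivity)
      (max_lt ((div_lt_one hp0).2 hp) ((div_lt_one hq0).2 hq))
  have hφp : ∀ r, 0 < r → 1 / r ≤ max (1 / p) (1 / q) → ∀ s, 0 ≤ s →
      |deriv φ s| ≤ K * φ s ^ (1 / r) ∧ |iteratedDeriv 2 φ s| ≤ K * φ s ^ (1 / r) := by
    intro r hr hrm s hs
    have := Real.rpow_le_rpow_of_exponent_ge' (hφ0 s) (hφle s hs) (by positivity) hrm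
    exact ⟨(hφK s hs).1.trans (by gcongr), (hφK s hs).2.trans (by gcongr)⟩
  have hφd : deriv φ 1 = 0 := by
    have := (hφp p hp0 (le_max_left _ _) 1 zero_le_one).1
    rw [hφ1 1 le_rfl, Real.zero_rpow (by positivity), mul_zero] at this
    exact abs_nonpos_iff.1 this
  set a := min (φ 0) (-deriv φ 0)
  have ha : 0 < a := lt_min hφpos (neg_pos.2 hφneg)
  set K₁ := (K * (1 + b)) ^ q
  set K₂ := K ^ p
  have hK₁ : 0 ≤ K₁ := by positivity
  have hK₂ : 0 ≤ K₂ := by positivity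
  refine ⟨max (K₁ ^ p * K₂) (K₂ ^ q * K₁) / a ^ (p * q - 1), by positivity, ?_⟩
  intro u₀ u₁ v₀ v₁ hu₀ hu₁ hv₀ hv₁ ε T τ u v hε hτ hτT hsol
  obtain ⟨hu, hv, hwu, hwv⟩ := hsol
  have hτ0 : 0 < τ := by linarith
  have iu₀ := Lp.integral_nonneg_of_nonneg hu₀
  have iu₁ := Lp.integral_nonneg_of_nonneg hu₁
  have iv₀ := Lp.integral_nonneg_of_nonneg hv₀
  have iv₁ := Lp.integral_nonneg_of_nonneg hv₁
  have hnφ : 0 < -deriv φ 0 := neg_pos.2 hφneg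
  -- Since `τ ≥ 1`, the term of order `τ⁻²` is dominated by the damping term of order `τ⁻¹`.
  have E₁ := hwu.rpow_le hq hu hτ0 hτT hφ hφ0 hφ1 hφd (D := K * (1 + b) / τ) (by positivity)
    (fun s hs => by
      obtain ⟨h1, h2⟩ := hφp q hq0 (le_max_right _ _) s hs
      have hZ : 0 ≤ φ s ^ (1 / q) := Real.rpow_nonneg (hφ0 s) _
      calc |iteratedDeriv 2 φ s / τ ^ 2 - b * (deriv φ s / τ)|
          ≤ |iteratedDeriv 2 φ s| / τ ^ 2 + b * (|deriv φ s| / τ) := by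
            refine (abs_sub _ _).trans_eq ?_
            rw [abs_div, abs_mul, abs_div, abs_of_pos hb, abs_of_pos hτ0,
              abs_of_pos (pow_pos hτ0 2)]
        _ ≤ K * φ s ^ (1 / q) / τ + b * (K * φ s ^ (1 / q) / τ) := by
            gcongr
            exact le_self_pow₀ hτ two_ne_zero
        _ = _ := by ring) (by positivity)
  have E₂ := hwv.rpow_le hp hv hτ0 hτT hφ hφ0 hφ1 hφd (D := K / τ ^ 2) (by positivity)
    (fun s hs => by
      obtain ⟨-, h2⟩ := hφp p hp0 (le_max_left _ _) s hs
      rw [zero_mul, sub_zero, abs_div, abs_of_pos (pow_pos hτ0 2), div_mul_eq_mul_div]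
      gcongr) (by positivity)
  set X := ∫ s in (0 : ℝ)..τ, (∫ x, |v s x| ^ p ∂μ) * φ (s / τ)
  set Y := ∫ s in (0 : ℝ)..τ, (∫ x, |u s x| ^ q ∂μ) * φ (s / τ)
  have hX : 0 ≤ X := intervalIntegral.integral_nonneg hτ0.le fun s _ =>
    mul_nonneg (integral_nonneg fun x => Real.rpow_nonneg (abs_nonneg _) _) (hφ0 _)
  have hY : 0 ≤ Y := intervalIntegral.integral_nonneg hτ0.le fun s _ =>
    mul_nonneg (integral_nonneg fun x => Real.rpow_nonneg (abs_nonneg _) _) (hφ0 _)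
  set A := a * (ε * ((∫ x, u₁ x ∂μ) + b * ∫ x, u₀ x ∂μ)) with hAdef
  set B := a * (ε * ((∫ x, v₁ x ∂μ) + (∫ x, v₀ x ∂μ) / τ)) with hBdef
  have hA : 0 ≤ A := by positivity
  have hB : 0 ≤ B := by positivity
  -- The `-deriv φ 0 / τ` part of the `u₀` term is discarded, as damping already supplies a `τ`-free
  -- weight. For `v₀` below it is all there is.
  have hAle : A ≤ ε * (φ 0 * (∫ x, u₁ x ∂μ) + (-deriv φ 0 / τ + b * φ 0) * ∫ x, u₀ x ∂μ) := by
    calc A = ε * (a * (∫ x, u₁ x ∂μ) + (0 + b * a) * ∫ x, u₀ x ∂μ) := by rw [hAdef]; ring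
      _ ≤ _ := by
        gcongr
        · exact min_le_left _ _
        · positivity
        · exact min_le_left _ _
  have hBle : B ≤ ε * (φ 0 * (∫ x, v₁ x ∂μ) + (-deriv φ 0 / τ + 0 * φ 0) * ∫ x, v₀ x ∂μ) := by
    calc B = ε * (a * (∫ x, v₁ x ∂μ) + (a / τ + 0 * φ 0) * ∫ x, v₀ x ∂μ) := by rw [hBdef]; ring
      _ ≤ _ := by
        gcongr
        · exact min_le_left _ _
        · exact min_le_right _ _
  have e₁ : (K * (1 + b) / τ) ^ q * τ ^ (q - 1) = K₁ * τ ^ (-1 : ℝ) := by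
    rw [Real.div_rpow (by positivity) hτ0.le, div_mul_eq_mul_div, mul_div_assoc,
      ← Real.rpow_sub hτ0]
    congr 2; ring
  have e₂ : (K / τ ^ 2) ^ p * τ ^ (p - 1) = K₂ * τ ^ (-(p + 1)) := by
    rw [Real.div_rpow hK.le (by positivity), ← Real.rpow_natCast τ 2, ← Real.rpow_mul hτ0.le,
      div_mul_eq_mul_div, mul_div_assoc, ← Real.rpow_sub hτ0]
    congr 2; push_cast; ring
  rw [e₁] at E₁
  rw [e₂] at E₂
  have F₁ : (X + A) ^ q ≤ K₁ * τ ^ (-1 : ℝ) * Y :=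
    (Real.rpow_le_rpow (by positivity) (by gcongr) hq0.le).trans E₁
  have F₂ : (Y + B) ^ p ≤ K₂ * τ ^ (-(p + 1)) * X :=
    (Real.rpow_le_rpow (by positivity) (by gcongr) hp0.le).trans E₂
  -- Each elimination keeps one data term and drops the other by monotonicity.
  have G₁ := rpow_le_of_coupled hp hq hX hY hA (by positivity) (by positivity) F₁
    ((Real.rpow_le_rpow hY (by linarith) hp0.le).trans F₂)
  have G₂ := rpow_le_of_coupled hq hp hY hX hB (by positivity) (by positivity) F₂
    ((Real.rpow_le_rpow hX (by linarith) hq0.le).trans F₁)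
  rw [mul_comm q p] at G₂
  rw [hAdef, Real.mul_rpow ha.le (by positivity)] at G₁
  rw [hBdef, Real.mul_rpow ha.le (by positivity)] at G₂
  have t₁ : (τ ^ (-1 : ℝ)) ^ p * τ ^ (-(p + 1)) * τ ^ (2 * p + 1) = 1 := by
    rw [← Real.rpow_mul hτ0.le, ← Real.rpow_add hτ0, ← Real.rpow_add hτ0]
    exact (congrArg (τ ^ ·) (by ring)).trans (Real.rpow_zero τ)
  have t₂ : (τ ^ (-(p + 1))) ^ q * τ ^ (-1 : ℝ) * τ ^ (p * q + q + 1) = 1 := by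
    rw [← Real.rpow_mul hτ0.le, ← Real.rpow_add hτ0, ← Real.rpow_add hτ0]
    exact (congrArg (τ ^ ·) (by ring)).trans (Real.rpow_zero τ)
  constructor
  · rw [le_div_iff₀ (by positivity)]
    refine le_trans ?_ (le_max_left _ _)
    calc _ = a ^ (p * q - 1) * (ε * ((∫ x, u₁ x ∂μ) + b * ∫ x, u₀ x ∂μ)) ^ (p * q - 1)
            * τ ^ (2 * p + 1) := by ring
      _ ≤ (K₁ * τ ^ (-1 : ℝ)) ^ p * (K₂ * τ ^ (-(p + 1))) * τ ^ (2 * p + 1) := by gcongr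
      _ = K₁ ^ p * K₂ * ((τ ^ (-1 : ℝ)) ^ p * τ ^ (-(p + 1)) * τ ^ (2 * p + 1)) := by
          rw [Real.mul_rpow hK₁ (by positivity)]; ring
      _ = _ := by rw [t₁, mul_one]
  · rw [le_div_iff₀ (by positivity)]
    refine le_trans ?_ (le_max_right _ _)
    calc _ = a ^ (p * q - 1) * (ε * ((∫ x, v₁ x ∂μ) + (∫ x, v₀ x ∂μ) / τ)) ^ (p * q - 1)
            * τ ^ (p * q + q + 1) := by ring
      _ ≤ (K₂ * τ ^ (-(p + 1))) ^ q * (K₁ * τ ^ (-1 : ℝ)) * τ ^ (p * q + q + 1) := by gcongr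
      _ = K₂ ^ q * K₁ * ((τ ^ (-(p + 1))) ^ q * τ ^ (-1 : ℝ) * τ ^ (p * q + q + 1)) := by
          rw [Real.mul_rpow hK₂ (by positivity)]; ring
      _ = _ := by rw [t₂, mul_one]

/-! ### Lifespan estimates -/

theorem lifespan_le {g : SmoothMetric n M} {μ : Measure M} {b m p q ε S : ℝ}
    {u₀ u₁ v₀ v₁ : Lp ℝ 2 μ} {u v : ℝ → Lp ℝ 2 μ}
    (h : ∀ T, IsEnergySolution g μ b m p q ε u₀ u₁ v₀ v₁ T u v → T ≤ S) :
    lifespan g μ b m p q ε u₀ u₁ v₀ v₁ u v ≤ ENNReal.ofReal S := by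
  refine sSup_le ?_
  rintro _ ⟨T, ⟨-, hT⟩, rfl⟩
  exact ENNReal.ofReal_le_ofReal (h T hT)

end

theorem theorem2p2 {n : ℕ} {G : Type*} [Group G] [TopologicalSpace G]
    [ChartedSpace (EuclideanSpace ℝ (Fin n)) G] [LieGroup (𝓡 n) ∞ G]
    [CompactSpace G] [T2Space G] [MeasurableSpace G] [BorelSpace G]
    (μ : Measure G) [μ.IsHaarMeasure] [IsProbabilityMeasure μ]
    (g : SmoothMetric n G) (hg : IsBiinvariantMetric g)
    (b p q : ℝ) (hb : 0 < b) (hp : 1 < p) (hq : 1 < q)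
    (u₀ u₁ v₀ v₁ : Lp ℝ 2 μ)
    (hu₀ : MemSobolevH1 g μ u₀) (hv₀ : MemSobolevH1 g μ v₀)
    (hu₀_nonneg : 0 ≤ u₀) (hu₁_nonneg : 0 ≤ u₁) (hv₀_nonneg : 0 ≤ v₀) (hv₁_nonneg : 0 ≤ v₁)
    (hu : u₀ ≠ 0 ∨ u₁ ≠ 0) (hv : v₀ ≠ 0 ∨ v₁ ≠ 0) :
    ∃ ε₀ : ℝ, 0 < ε₀ ∧ ∃ C : ℝ, 0 < C ∧
      ∀ ε : ℝ, 0 < ε → ε ≤ ε₀ → ∀ u v : ℝ → Lp ℝ 2 μ,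
        (∃ T : ℝ, 0 < T ∧ IsEnergySolution g μ b 0 p q ε u₀ u₁ v₀ v₁ T u v) →
        lifespan g μ b 0 p q ε u₀ u₁ v₀ v₁ u v < ⊤ ∧
        (v₁ ≠ 0 → lifespan g μ b 0 p q ε u₀ u₁ v₀ v₁ u v ≤
          ENNReal.ofReal (C * ε ^ (-((p * q - 1) / max (2 * p + 1) (p * q + q + 1))))) ∧
        (v₁ = 0 → lifespan g μ b 0 p q ε u₀ u₁ v₀ v₁ u v ≤
          ENNReal.ofReal (C * ε ^ (-((p * q - 1) / max (2 * p + 1) (q + 2))))) := by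
  have hpq : 0 < p * q - 1 := by nlinarith
  obtain ⟨K, hK, hbound⟩ := IsEnergySolution.exists_bound g μ hb hp hq
  have hD : 0 < (∫ x, u₁ x ∂μ) + b * ∫ x, u₀ x ∂μ := by
    rcases hu with h | h
    · exact add_pos_of_nonneg_of_pos (Lp.integral_nonneg_of_nonneg hu₁_nonneg)
        (mul_pos hb (Lp.integral_pos_of_nonneg_of_ne_zero hu₀_nonneg h))
    · exact add_pos_of_pos_of_nonneg (Lp.integral_pos_of_nonneg_of_ne_zero hu₁_nonneg h)
        (mul_nonneg hb.le (Lp.integral_nonneg_of_nonneg hu₀_nonneg))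
  set c : ℝ → ℝ → ℝ := fun Q m => max 1 ((K / Q ^ (p * q - 1)) ^ (1 / m))
  -- One entry per mechanism: damped data, `v₁`, `v₀`. If a mean of `v₁` or `v₀` vanishes, division
  -- by zero gives `0` and its entry is harmlessly `1`.
  set C := max (c ((∫ x, u₁ x ∂μ) + b * ∫ x, u₀ x ∂μ) (2 * p + 1))
    (max (c (∫ x, v₁ x ∂μ) (p * q + q + 1)) (c (∫ x, v₀ x ∂μ) (q + 2)))
  have hC : 0 < C := lt_max_of_lt_left (lt_max_of_lt_left one_pos)
  refine ⟨1, one_pos, C, hC, fun ε hε hε1 u v _ => ?_⟩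
  have damped : ∀ T, IsEnergySolution g μ b 0 p q ε u₀ u₁ v₀ v₁ T u v →
      T ≤ C * ε ^ (-((p * q - 1) / (2 * p + 1))) := fun T hT =>
    (le_mul_rpow_of_forall_rpow_mul_rpow_le hε hε1 hD hpq.le (by linarith) hK fun τ hτ hτT =>
      (hbound u₀ u₁ v₀ v₁ hu₀_nonneg hu₁_nonneg hv₀_nonneg hv₁_nonneg ε T τ u v hε hτ hτT
        hT).1).trans (by gcongr; exact le_max_left _ _)
  have ne_case : v₁ ≠ 0 → lifespan g μ b 0 p q ε u₀ u₁ v₀ v₁ u v ≤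
      ENNReal.ofReal (C * ε ^ (-((p * q - 1) / max (2 * p + 1) (p * q + q + 1)))) := by
    intro hv₁
    refine lifespan_le fun T hT => ?_
    rcases max_choice (2 * p + 1) (p * q + q + 1) with h | h <;> rw [h]
    · exact damped T hT
    refine (le_mul_rpow_of_forall_rpow_mul_rpow_le (m := p * q + q + 1) hε hε1
      (Lp.integral_pos_of_nonneg_of_ne_zero hv₁_nonneg hv₁) hpq.le (by nlinarith) hK
      fun τ hτ hτT => le_trans ?_ (hbound u₀ u₁ v₀ v₁ hu₀_nonneg hu₁_nonneg hv₀_nonneg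
        hv₁_nonneg ε T τ u v hε hτ hτT hT).2).trans
      (by gcongr; exact le_max_of_le_right (le_max_left _ _))
    have i₀ := Lp.integral_nonneg_of_nonneg hv₀_nonneg
    have i₁ := Lp.integral_nonneg_of_nonneg hv₁_nonneg
    gcongr
    exact le_add_of_nonneg_right (by positivity)
  have eq_case : v₁ = 0 → lifespan g μ b 0 p q ε u₀ u₁ v₀ v₁ u v ≤
      ENNReal.ofReal (C * ε ^ (-((p * q - 1) / max (2 * p + 1) (q + 2)))) := by
    intro hv₁
    refine lifespan_le fun T hT => ?_
    rcases max_choice (2 * p + 1) (q + 2) with h | h <;> rw [h]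
    · exact damped T hT
    refine (le_mul_rpow_of_forall_rpow_mul_rpow_le (m := q + 2) hε hε1
      (Lp.integral_pos_of_nonneg_of_ne_zero hv₀_nonneg (hv.resolve_right (not_not.2 hv₁)))
      hpq.le (by linarith) hK
      fun τ hτ hτT => le_trans ?_ (hbound u₀ u₁ v₀ v₁ hu₀_nonneg hu₁_nonneg hv₀_nonneg
        hv₁_nonneg ε T τ u v hε hτ hτT hT).2).trans
      (by gcongr; exact le_max_of_le_right (le_max_right _ _))
    have i₀ := Lp.integral_nonneg_of_nonneg hv₀_nonneg
    have i₁ := Lp.integral_nonneg_of_nonneg hv₁_nonneg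
    have hτ0 : 0 < τ := by linarith
    -- Pulling `τ⁻¹` out of the power costs `τ ^ (pq - 1)`, and `(pq + q + 1) - (pq - 1) = q + 2`.
    calc (ε * ∫ x, v₀ x ∂μ) ^ (p * q - 1) * τ ^ (q + 2)
        = (ε * ((∫ x, v₀ x ∂μ) / τ)) ^ (p * q - 1) * τ ^ (p * q + q + 1) := by
          rw [← mul_div_assoc, Real.div_rpow (by positivity) hτ0.le, div_mul_eq_mul_div,
            mul_div_assoc, ← Real.rpow_sub hτ0]
          congr 2; ring
      _ ≤ _ := by
          gcongr
          exact le_add_of_nonneg_left i₁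
  refine ⟨?_, ne_case, eq_case⟩
  by_cases hv₁ : v₁ = 0
  · exact (eq_case hv₁).trans_lt ENNReal.ofReal_lt_top
  · exact (ne_case hv₁).trans_lt ENNReal.ofReal_lt_top
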